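/- Consider a unit sphere at position $x\in\mathbb{R}^3$ moving with velocity $\dot x=f$, where $f(t)\in\mathbb{R}^3$ is the control, and a tracer at relative position $r\in\mathbb{R}^3$ that is advected by the exact Stokes flow (Stokeslet plus potential dipole) around the sphere, so that $$\dot r=\tfrac34\Bigl(\frac{I}{\|r\|}+\frac{rr^T}{\|r\|^3}\Bigr)f+\tfrac14\Bigl(\frac{I}{\|r\|^3}-\frac{3\,rr^T}{\|r\|^5}\Bigr)f-f .$$ Write this driftless system with state $X=(r,x)\in\mathbb{R}^6$ as $\dot X=\sum_{i\in\{x,y,z\}}f_i\,g_i(X)$, let $\tilde g_i$ be the $r$-component of $g_i$ (a field on $\mathbb{R}^3\setminus\{0\}$), let $P=\{(r,x)\in\mathbb{R}^6:\|r\|>1\}$ be the admissible state space, and use the Lie bracket $[V,W]=(\nabla W)V-(\nabla V)W$. Then: 1. The system is controllable everywhere in $P$: for all $X_0,X_1\in P$ and every $T>0$ there is a bounded measurable control $f$ on $[0,T]$ and a corresponding (absolutely continuous) solution $X$ of the system that stays in $P$ on $[0,T]$ and satisfies $X(0)=X_0$, $X(T)=X_1$. 2. At every $X\in P$ the values at $X$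 of all iterated Lie brackets of $g_x,g_y,g_z$ (these fields included) span a space of dimension $6$; that is, the controllable state set equals $P$. 3. For all $i,j\in\{x,y,z\}$ and $r\neq0$, with $\rho=\|r\|$, $$[\tilde g_i,\tilde g_j](r)=\frac{-3(\rho-1)^2(8\rho^3+7\rho^2+6\rho+3)}{16\rho^8}\,(r_je_i-r_ie_j).$$ If $\|r\|>1$, these second-order brackets span a space of dimension $2$; at $r=\rho e_x$, $\rho>1$, it is the span of $e_y$ and $e_z$. 4. At $r=\rho e_x$ with $\rho>0$, the brackets $[\tilde g_y,[\tilde g_x,\tilde g_y]]$ and $[\tilde g_z,[\tilde g_x,\tilde g_z]]$ both have $e_x$-component $$\frac{3(\rho-1)^4(2\rho+1)(8\rho^3+7\rho^2+6\rho+3)}{32\rho^{11}} .$$ 5. For $\rho>1$ neither $(\rho-1)^2(8\rho^3+7\rho^2+6\rho+3)$ nor $(\rho-1)^4(2\rho+1)(8\rho^3+7\rho^2+6\rho+3)$ vanishes, and at $r=\rho e_x$ the brackets $[\tilde g_x,\tilde g_y]$, $[\tilde g_x,\tilde g_z]$ together with either of the two third-order brackets of item 4 span $\mathbb{R}^3$.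 -/

import Mathlib

/-- Physical space `ℝ³` with its Euclidean norm; the indices `0, 1, 2` stand for `x, y, z`. -/
abbrev R3 : Type := EuclideanSpace ℝ (Fin 3)

section ControlSystems

variable {E : Type*} [NormedAddCommGroup E] [NormedSpace ℝ E] {ι : Type*}

/-- The time-dependent control `F`, bounded and measurable on `[0, T]`, drives the state along the
curve `X` for the driftless control-affine system `dX/dt = ∑ i, F_i(t) g_i(X)` on the state
space `P`: the curve is continuous, stays in `P` on `[0, T]`, and solves the equation in integral
form (that is, it is absolutely continuous and solves it for almost every time). -/
structure IsTrajectory [Fintype ι] (P : Set E) (g : ι → E → E) (T : ℝ)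
    (F : ι → ℝ → ℝ) (X : ℝ → E) : Prop where
  measurable_control : ∀ i, Measurable (F i)
  bounded_control : ∃ C : ℝ, ∀ i, ∀ t ∈ Set.Icc 0 T, |F i t| ≤ C
  continuousOn_state : ContinuousOn X (Set.Icc 0 T)
  mem_stateSpace : ∀ t ∈ Set.Icc 0 T, X t ∈ P
  integrable_velocity :
    IntervalIntegrable (fun t => ∑ i, F i t • g i (X t)) MeasureTheory.volume 0 T
  state_eq : ∀ t ∈ Set.Icc 0 T, X t = X 0 + ∫ s in (0 : ℝ)..t, ∑ i, F i s • g i (X s)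

/-- The system with fields `g` on the state space `P` is controllable within `Q`: any state of `Q`
can be transported to any other one in any prescribed positive time. -/
def IsControllableWithin [Fintype ι] (P : Set E) (g : ι → E → E) (Q : Set E) : Prop :=
  ∀ X₀ ∈ Q, ∀ X₁ ∈ Q, ∀ T : ℝ, 0 < T →
    ∃ (F : ι → ℝ → ℝ) (X : ℝ → E), IsTrajectory P g T F X ∧ X 0 = X₀ ∧ X T = X₁

/-- `IsIteratedBracket g V`: the field `V` is one of the iterated Lie brackets of the fields `g_i`
(the `g_i` themselves included). Mathlib's Lie bracket of vector fields is
`[V, W] = (∇W) V - (∇V) W`. -/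
inductive IsIteratedBracket (g : ι → E → E) : (E → E) → Prop
  | field (i : ι) : IsIteratedBracket g (g i)
  | bracket {V W : E → E} (hV : IsIteratedBracket g V) (hW : IsIteratedBracket g W) :
      IsIteratedBracket g (VectorField.lieBracket ℝ V W)

/-- The space `B(X)` spanned by the values at `X` of all iterated Lie brackets. -/
def bracketSpan (g : ι → E → E) (X : E) : Submodule ℝ E :=
  Submodule.span ℝ {v | ∃ V, IsIteratedBracket g V ∧ V X = v}

/-- The controllable state set `S = {X ∈ P : dim B(X) = n}`, `n` the dimension of the state. -/
def controllableStateSet (P : Set E) (g : ι → E → E) : Set E :=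
  {X | X ∈ P ∧ Module.finrank ℝ (bracketSpan g X) = Module.finrank ℝ E}

end ControlSystems

section Tracer

noncomputable section

/-- The standard basis vectors `e_x, e_y, e_z`. -/
def basisVec (i : Fin 3) : R3 := EuclideanSpace.single i (1 : ℝ)

/-- Velocity of the tracer relative to the sphere, at relative position `r`, when the control
is `f`: Stokeslet, plus potential dipole, minus the velocity `f` of the sphere. Here
`(r rᵀ) f` is written `⟪r, f⟫ r`. -/
def relativeVelocity (f r : R3) : R3 :=
  (3 / 4 : ℝ) • ((1 / ‖r‖) • f + (1 / ‖r‖ ^ 3) • (inner ℝ r f • r))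
    + (1 / 4 : ℝ) • ((1 / ‖r‖ ^ 3) • f - (3 / ‖r‖ ^ 5) • (inner ℝ r f • r))
    - f

/-- The fields `g̃_i` on the space of relative positions. -/
def relativeField (i : Fin 3) (r : R3) : R3 := relativeVelocity (basisVec i) r

/-- The fields `g_i` of the full system, with state `(r, x)`: `r` the position of the tracer
relative to the sphere and `x` the position of the sphere, which moves with velocity `f`. -/
def sphereTracerField (i : Fin 3) (X : R3 × R3) : R3 × R3 :=
  (relativeField i X.1, basisVec i)

/-- The admissible state space: the tracer is outside the unit control sphere. -/
def admissibleSpace : Set (R3 × R3) := {X | 1 < ‖X.1‖}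

end

end Tracer

/-!
Write `ρ = ‖r‖`. The field `g̃_i` is `A(ρ) e_i + B(ρ) r_i r`, with `A = transverseCoeff` and
`B = dyadicCoeff`; the linear map `f ↦ ṙ` multiplies vectors orthogonal to `r` by `A` and multiples
of `r` by `A + B ρ² = radialCoeff`, and neither factor vanishes for `ρ > 1`.

*Brackets.* Differentiating gives `[g̃_i, g̃_j] = c (r_j e_i - r_i e_j)` with
`c = A B - A' (A + B ρ²) / ρ` (`lieBracket_relativeField`), and these vectors span the plane
orthogonal to `r`. Because second-order brackets are everywhere orthogonal to `r`, the radial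
part of a third-order bracket needs no derivative of `c`
(`inner_lieBracket_lieBracket_relativeField`); it is nonzero for a suitable choice of indices, so
brackets of orders two and three span `ℝ³` at every `r` with `ρ > 1`. In the full system all
brackets of order at least two have sphere component zero, while the `g_i` themselves have sphere
component `e_i`, which gives rank six.

*Controllability.* As `f ↦ ṙ` is invertible, the tracer can follow any smooth path outside the
sphere, and the displacement of `x` is the integral of an `ℝ³`-valued one-form along this path.
A radial move in the direction `u` displaces the sphere by a multiple of `u` that depends only on
the two distances, and a great arc of radius `ρ` from direction `u` to direction `w` displaces it by
`(ρ / A) (w - u)`. Going out along `p`, across to `q`, back in, and across to `p` therefore returns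
the tracer and displaces the sphere by `κ (p - q)`, where `κ ≠ 0` for suitable distances
(`exists_loopShift_ne_zero`). Every vector of norm at most two is a difference `p - q` of unit
vectors, so repeated loops produce every displacement (`canSteer_translate`), and radial moves and
arcs bring the tracer to its target.
-/

open scoped Topology

noncomputable section

/-! ### Coefficients of the flow -/

/-- The eigenvalue, at distance `ρ`, of the linear map `f ↦ relativeVelocity f r` on the plane
orthogonal to `r`. -/
def transverseCoeff (ρ : ℝ) : ℝ := 3 / 4 * (1 / ρ) + 1 / 4 * (1 / ρ ^ 3) - 1

/-- The coefficient of `(r rᵀ) f` in `relativeVelocity f r`, at distance `ρ`. -/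
def dyadicCoeff (ρ : ℝ) : ℝ := 3 / 4 * (1 / ρ ^ 3) - 1 / 4 * (3 / ρ ^ 5)

/-- The eigenvalue of `f ↦ relativeVelocity f r` in the direction of `r`, at distance `ρ`. -/
def radialCoeff (ρ : ℝ) : ℝ := transverseCoeff ρ + dyadicCoeff ρ * ρ ^ 2

/-- The scalar factor of the second-order brackets, at distance `ρ`. -/
def bracketCoeff (ρ : ℝ) : ℝ :=
  -3 * (ρ - 1) ^ 2 * (8 * ρ ^ 3 + 7 * ρ ^ 2 + 6 * ρ + 3) / (16 * ρ ^ 8)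

lemma relativeVelocity_eq (f r : R3) :
    relativeVelocity f r =
      transverseCoeff ‖r‖ • f + (dyadicCoeff ‖r‖ * inner ℝ r f) • r := by
  unfold relativeVelocity transverseCoeff dyadicCoeff
  module

lemma inner_basisVec (r : R3) (i : Fin 3) : inner ℝ r (basisVec i) = r i := by
  simp [basisVec, EuclideanSpace.inner_single_right]

lemma relativeField_eq (i : Fin 3) (r : R3) :
    relativeField i r = transverseCoeff ‖r‖ • basisVec i + (dyadicCoeff ‖r‖ * r i) • r := by
  rw [relativeField, relativeVelocity_eq, inner_basisVec]

lemma sum_smul_basisVec (r : R3) : ∑ i, r i • basisVec i = r := by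
  ext j
  fin_cases j <;> simp [Fin.sum_univ_three, basisVec]

lemma transverseCoeff_eq {ρ : ℝ} (hρ : ρ ≠ 0) :
    transverseCoeff ρ = -((ρ - 1) * (4 * ρ ^ 2 + ρ + 1)) / (4 * ρ ^ 3) := by
  unfold transverseCoeff
  field_simp
  ring

lemma radialCoeff_eq {ρ : ℝ} (hρ : ρ ≠ 0) :
    radialCoeff ρ = -((ρ - 1) ^ 2 * (2 * ρ + 1)) / (2 * ρ ^ 3) := by
  unfold radialCoeff transverseCoeff dyadicCoeff
  field_simp
  ring

lemma transverseCoeff_ne_zero {ρ : ℝ} (hρ : 1 < ρ) : transverseCoeff ρ ≠ 0 := by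
  rw [transverseCoeff_eq (by positivity)]
  have : 0 < ρ - 1 := by linarith
  have : 0 < (ρ - 1) * (4 * ρ ^ 2 + ρ + 1) / (4 * ρ ^ 3) := by positivity
  rw [neg_div]
  exact this.ne' ∘ neg_eq_zero.mp

lemma radialCoeff_ne_zero {ρ : ℝ} (hρ : 1 < ρ) : radialCoeff ρ ≠ 0 := by
  rw [radialCoeff_eq (by positivity)]
  have : 0 < ρ - 1 := by linarith
  have : 0 < (ρ - 1) ^ 2 * (2 * ρ + 1) / (2 * ρ ^ 3) := by positivity
  rw [neg_div]
  exact this.ne' ∘ neg_eq_zero.mp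

lemma bracketCoeff_ne_zero {ρ : ℝ} (hρ : 1 < ρ) : bracketCoeff ρ ≠ 0 := by
  have : 0 < ρ - 1 := by linarith
  have : 0 < 3 * (ρ - 1) ^ 2 * (8 * ρ ^ 3 + 7 * ρ ^ 2 + 6 * ρ + 3) / (16 * ρ ^ 8) := by positivity
  rw [bracketCoeff, neg_mul, neg_mul, neg_div]
  exact this.ne' ∘ neg_eq_zero.mp

/-! ### Derivatives of the fields -/

lemma hasDerivAt_inv_pow {ρ : ℝ} (hρ : ρ ≠ 0) (n : ℕ) :
    HasDerivAt (fun s : ℝ => 1 / s ^ n) (-n / ρ ^ (n + 1)) ρ := by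
  have h := ((hasDerivAt_pow n ρ).inv (pow_ne_zero n hρ))
  simp only [one_div]
  refine h.congr_deriv ?_
  cases n with
  | zero => simp
  | succ n =>
    simp only [Nat.add_sub_cancel]
    field_simp
    ring

lemma hasDerivAt_transverseCoeff {ρ : ℝ} (hρ : ρ ≠ 0) :
    HasDerivAt transverseCoeff (-3 / (4 * ρ ^ 2) - 3 / (4 * ρ ^ 4)) ρ := by
  have h := (((hasDerivAt_inv_pow hρ 1).const_mul (3 / 4)).add
    ((hasDerivAt_inv_pow hρ 3).const_mul (1 / 4))).sub_const 1
  refine (h.congr_deriv ?_).congr_of_eventuallyEq (.of_forall fun s => ?_)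
  · push_cast; field_simp; ring
  · simp [transverseCoeff]

lemma differentiableAt_dyadicCoeff {ρ : ℝ} (hρ : ρ ≠ 0) :
    DifferentiableAt ℝ dyadicCoeff ρ := by
  unfold dyadicCoeff
  fun_prop (disch := simpa using hρ)

lemma differentiableAt_bracketCoeff {ρ : ℝ} (hρ : ρ ≠ 0) :
    DifferentiableAt ℝ bracketCoeff ρ := by
  unfold bracketCoeff
  fun_prop (disch := simpa using hρ)

/-- A differentiable function of the distance has the derivative `φ'(‖r‖) ⟪r, ·⟫ / ‖r‖`. -/
lemma hasFDerivAt_comp_norm {φ : ℝ → ℝ} {φ' : ℝ} {r : R3} (hr : r ≠ 0)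
    (hφ : HasDerivAt φ φ' ‖r‖) :
    HasFDerivAt (fun s : R3 => φ ‖s‖) ((φ' / ‖r‖) • innerSL ℝ r) r := by
  have hn : ‖r‖ ≠ 0 := norm_ne_zero_iff.mpr hr
  have h1 : HasFDerivAt (fun s : R3 => ‖s‖) ((1 / ‖r‖) • innerSL ℝ r) r := by
    have h2 := (hasStrictFDerivAt_norm_sq r).hasFDerivAt.sqrt (by positivity)
    simp only [Real.sqrt_sq (norm_nonneg _)] at h2
    refine h2.congr_fderiv ?_
    ext v
    simp
    field_simp
  refine (hφ.comp_hasFDerivAt r h1).congr_fderiv ?_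
  rw [smul_smul, mul_one_div]

lemma hasFDerivAt_coord (i : Fin 3) (r : R3) :
    HasFDerivAt (fun s : R3 => s i) (EuclideanSpace.proj i : R3 →L[ℝ] ℝ) r :=
  (EuclideanSpace.proj i : R3 →L[ℝ] ℝ).hasFDerivAt

/-- The derivative of `g̃_i` at `r`, given by its values on increments `h`. -/
lemma hasFDerivAt_relativeField (i : Fin 3) {r : R3} (hr : r ≠ 0) :
    ∃ D : R3 →L[ℝ] R3, HasFDerivAt (relativeField i) D r ∧ ∀ h : R3,
      D h = ((deriv transverseCoeff ‖r‖ / ‖r‖) * inner ℝ r h) • basisVec i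
        + ((deriv dyadicCoeff ‖r‖ / ‖r‖) * inner ℝ r h * r i + dyadicCoeff ‖r‖ * h i) • r
        + (dyadicCoeff ‖r‖ * r i) • h := by
  have hn : ‖r‖ ≠ 0 := norm_ne_zero_iff.mpr hr
  have hA := hasFDerivAt_comp_norm hr
    (hasDerivAt_transverseCoeff hn).differentiableAt.hasDerivAt
  have hB := hasFDerivAt_comp_norm hr (differentiableAt_dyadicCoeff hn).hasDerivAt
  have h := (hA.smul_const (basisVec i)).add
    ((hB.mul (hasFDerivAt_coord i r)).smul (hasFDerivAt_id r))
  refine ⟨_, h.congr_of_eventuallyEq (.of_forall fun s => relativeField_eq i s), fun v => ?_⟩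
  simp
  module

lemma differentiableAt_relativeField (i : Fin 3) {r : R3} (hr : r ≠ 0) :
    DifferentiableAt ℝ (relativeField i) r :=
  (hasFDerivAt_relativeField i hr).choose_spec.1.differentiableAt

/-! ### Second-order brackets -/

lemma inner_relativeField (i : Fin 3) (r : R3) :
    inner ℝ r (relativeField i r) = radialCoeff ‖r‖ * r i := by
  rw [relativeField_eq, inner_add_right, inner_smul_right, inner_smul_right, inner_basisVec,
    real_inner_self_eq_norm_sq, radialCoeff]
  ring

lemma lieBracket_relativeField {r : R3} (hr : r ≠ 0) (i j : Fin 3) :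
    VectorField.lieBracket ℝ (relativeField i) (relativeField j) r =
      bracketCoeff ‖r‖ • (r j • basisVec i - r i • basisVec j) := by
  have hn : ‖r‖ ≠ 0 := norm_ne_zero_iff.mpr hr
  obtain ⟨Di, hDi, hi⟩ := hasFDerivAt_relativeField i hr
  obtain ⟨Dj, hDj, hj⟩ := hasFDerivAt_relativeField j hr
  have hc : bracketCoeff ‖r‖ = transverseCoeff ‖r‖ * dyadicCoeff ‖r‖
      - deriv transverseCoeff ‖r‖ / ‖r‖ * radialCoeff ‖r‖ := by
    rw [(hasDerivAt_transverseCoeff hn).deriv]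
    unfold bracketCoeff radialCoeff transverseCoeff dyadicCoeff
    field_simp
    ring
  have hδ : basisVec i j = basisVec j i := by
    simp [basisVec, eq_comm]
  rw [VectorField.lieBracket, hDi.fderiv, hDj.fderiv, hi, hj, inner_relativeField,
    inner_relativeField, hc, relativeField_eq i, relativeField_eq j]
  simp only [PiLp.add_apply, PiLp.smul_apply, smul_eq_mul, hδ]
  module

lemma inner_lieBracket_relativeField {r : R3} (hr : r ≠ 0) (i j : Fin 3) :
    inner ℝ r (VectorField.lieBracket ℝ (relativeField i) (relativeField j) r) = 0 := by
  rw [lieBracket_relativeField hr, inner_smul_right, inner_sub_right, inner_smul_right,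
    inner_smul_right, inner_basisVec, inner_basisVec]
  ring

lemma lieBracket_relativeField_eventuallyEq {r : R3} (hr : r ≠ 0) (i j : Fin 3) :
    VectorField.lieBracket ℝ (relativeField i) (relativeField j) =ᶠ[𝓝 r]
      fun s => bracketCoeff ‖s‖ • (s j • basisVec i - s i • basisVec j) :=
  (eventually_ne_nhds hr).mono fun _ hs => lieBracket_relativeField hs i j

lemma differentiableAt_lieBracket_relativeField {r : R3} (hr : r ≠ 0) (i j : Fin 3) :
    DifferentiableAt ℝ (VectorField.lieBracket ℝ (relativeField i) (relativeField j)) r := by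
  have hC := (hasFDerivAt_comp_norm hr (differentiableAt_bracketCoeff
    (norm_ne_zero_iff.mpr hr)).hasDerivAt).differentiableAt
  refine DifferentiableAt.congr_of_eventuallyEq ?_ (lieBracket_relativeField_eventuallyEq hr i j)
  exact hC.smul (((hasFDerivAt_coord j r).differentiableAt.smul_const _).sub
    ((hasFDerivAt_coord i r).differentiableAt.smul_const _))

/-- The second-order brackets span the plane orthogonal to `r`, because
`‖r‖² w = ∑ i j, w_i r_j (r_j e_i - r_i e_j)` for `w` orthogonal to `r`. -/
lemma mem_of_inner_eq_zero {r : R3} (hr : 1 < ‖r‖) {S : Submodule ℝ R3}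
    (hS : ∀ i j, VectorField.lieBracket ℝ (relativeField i) (relativeField j) r ∈ S)
    {w : R3} (hw : inner ℝ r w = 0) : w ∈ S := by
  have hn : ‖r‖ ≠ 0 := by positivity
  have hr0 : r ≠ 0 := norm_ne_zero_iff.mp hn
  have hc := bracketCoeff_ne_zero hr
  have hS' : ∀ i j, r j • basisVec i - r i • basisVec j ∈ S := fun i j => by
    have h := S.smul_mem (bracketCoeff ‖r‖)⁻¹ (hS i j)
    rwa [lieBracket_relativeField hr0, inv_smul_smul₀ hc] at h
  have hsum : ‖r‖ ^ 2 • w =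
      ∑ i, ∑ j, (w i * r j) • (r j • basisVec i - r i • basisVec j) := by
    have hw' : w 0 * r 0 + w 1 * r 1 + w 2 * r 2 = 0 := by
      simpa [PiLp.inner_apply, Fin.sum_univ_three] using hw
    have hq : ‖r‖ ^ 2 = r 0 ^ 2 + r 1 ^ 2 + r 2 ^ 2 := by
      simp [EuclideanSpace.norm_sq_eq, Fin.sum_univ_three]
    rw [hq]
    ext k
    fin_cases k <;> simp [Fin.sum_univ_three, basisVec]
    · linear_combination r 0 * hw'
    · linear_combination r 1 * hw'
    · linear_combination r 2 * hw'
  have hmem : ‖r‖ ^ 2 • w ∈ S := by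
    rw [hsum]
    exact S.sum_mem fun i _ => S.sum_mem fun j _ => S.smul_mem _ (hS' i j)
  exact (S.smul_mem_iff (pow_ne_zero 2 hn)).mp hmem

lemma span_lieBracket_relativeField {r : R3} (hr : 1 < ‖r‖) :
    Submodule.span ℝ (Set.range fun p : Fin 3 × Fin 3 =>
      VectorField.lieBracket ℝ (relativeField p.1) (relativeField p.2) r) = (ℝ ∙ r)ᗮ := by
  have hr0 : r ≠ 0 := norm_ne_zero_iff.mp (by positivity)
  refine le_antisymm (Submodule.span_le.mpr ?_) fun w hw => ?_
  · rintro _ ⟨p, rfl⟩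
    exact Submodule.mem_orthogonal_singleton_iff_inner_right.mpr
      (inner_lieBracket_relativeField hr0 p.1 p.2)
  · refine mem_of_inner_eq_zero hr (fun i j => ?_)
      (Submodule.mem_orthogonal_singleton_iff_inner_right.mp hw)
    exact Submodule.subset_span ⟨(i, j), rfl⟩

/-! ### Third-order brackets -/

/-- The radial part of a third-order bracket. Since a second-order bracket `W` is everywhere
orthogonal to `r`, `⟪r, DW V⟫ = -⟪V, W⟫`, so no derivative of the coefficients enters. -/
lemma inner_lieBracket_lieBracket_relativeField {r : R3} (hr : r ≠ 0) (k i j : Fin 3) :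
    inner ℝ r (VectorField.lieBracket ℝ (relativeField k)
      (VectorField.lieBracket ℝ (relativeField i) (relativeField j)) r) =
    -(radialCoeff ‖r‖ * bracketCoeff ‖r‖ * (r j * basisVec i k - r i * basisVec j k)) := by
  set W := VectorField.lieBracket ℝ (relativeField i) (relativeField j) with hW
  obtain ⟨D, hD, hk⟩ := hasFDerivAt_relativeField k hr
  have hWr : inner ℝ r (W r) = 0 := inner_lieBracket_relativeField hr i j
  have hWk : W r k = bracketCoeff ‖r‖ * (r j * basisVec i k - r i * basisVec j k) := by
    rw [hW, lieBracket_relativeField hr]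
    simp
  have hder : inner ℝ r (fderiv ℝ W r (relativeField k r)) =
      -inner ℝ (relativeField k r) (W r) := by
    have h1 := (hasFDerivAt_id r).inner ℝ
      (differentiableAt_lieBracket_relativeField hr i j).hasFDerivAt
    have h2 : HasFDerivAt (fun s : R3 => inner ℝ (id s) (W s)) (0 : R3 →L[ℝ] ℝ) r :=
      (hasFDerivAt_const (0 : ℝ) r).congr_of_eventuallyEq
        ((eventually_ne_nhds hr).mono fun s hs => inner_lieBracket_relativeField hs i j)
    have h3 := congrArg (fun L : R3 →L[ℝ] ℝ => L (relativeField k r)) (h1.unique h2)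
    simp [fderivInnerCLM_apply] at h3
    linarith
  have hVW : inner ℝ (relativeField k r) (W r) = transverseCoeff ‖r‖ * W r k := by
    rw [relativeField_eq, inner_add_left, real_inner_smul_left, real_inner_smul_left, hWr,
      real_inner_comm, inner_basisVec]
    ring
  rw [VectorField.lieBracket, hD.fderiv, hk, inner_sub_right, hder, hVW, hWr]
  simp only [inner_add_right, inner_smul_right, hWr, real_inner_self_eq_norm_sq]
  rw [hWk, radialCoeff]
  ring

/-- The second-order brackets together with one vector that is not orthogonal to `r` span `ℝ³`. -/
lemma eq_top_of_lieBracket_mem {r : R3} (hr : 1 < ‖r‖) {S : Submodule ℝ R3}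
    (hS : ∀ i j, VectorField.lieBracket ℝ (relativeField i) (relativeField j) r ∈ S)
    {w : R3} (hw : w ∈ S) (hrw : inner ℝ r w ≠ 0) : S = ⊤ := by
  refine Submodule.eq_top_iff'.mpr fun v => ?_
  have h : v - (inner ℝ r v / inner ℝ r w) • w ∈ S := by
    refine mem_of_inner_eq_zero hr hS ?_
    rw [inner_sub_right, inner_smul_right]
    field_simp
    ring
  simpa using S.add_mem h (S.smul_mem (inner ℝ r v / inner ℝ r w) hw)

/-! ### Brackets of the full system -/

lemma lieBracket_prod_const {V W : R3 → R3} (a b : R3) {X : R3 × R3}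
    (hV : DifferentiableAt ℝ V X.1) (hW : DifferentiableAt ℝ W X.1) :
    VectorField.lieBracket ℝ (fun Y : R3 × R3 => (V Y.1, a)) (fun Y => (W Y.1, b)) X =
      (VectorField.lieBracket ℝ V W X.1, 0) := by
  have key : ∀ {U : R3 → R3} (c : R3), DifferentiableAt ℝ U X.1 →
      HasFDerivAt (fun Y : R3 × R3 => (U Y.1, c))
        (((fderiv ℝ U X.1).comp (ContinuousLinearMap.fst ℝ R3 R3)).prod 0) X := fun c hU =>
    (hU.hasFDerivAt.comp X hasFDerivAt_fst).prodMk (hasFDerivAt_const c X)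
  rw [VectorField.lieBracket, (key a hV).fderiv, (key b hW).fderiv]
  simp [VectorField.lieBracket]

lemma lieBracket_sphereTracerField (i j : Fin 3) {X : R3 × R3} (hX : X.1 ≠ 0) :
    VectorField.lieBracket ℝ (sphereTracerField i) (sphereTracerField j) X =
      (VectorField.lieBracket ℝ (relativeField i) (relativeField j) X.1, 0) :=
  lieBracket_prod_const _ _ (differentiableAt_relativeField i hX)
    (differentiableAt_relativeField j hX)

lemma lieBracket_lieBracket_sphereTracerField (k i j : Fin 3) {X : R3 × R3} (hX : X.1 ≠ 0) :
    VectorField.lieBracket ℝ (sphereTracerField k)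
      (VectorField.lieBracket ℝ (sphereTracerField i) (sphereTracerField j)) X =
      (VectorField.lieBracket ℝ (relativeField k)
        (VectorField.lieBracket ℝ (relativeField i) (relativeField j)) X.1, 0) := by
  have h : VectorField.lieBracket ℝ (sphereTracerField i) (sphereTracerField j) =ᶠ[𝓝 X]
      fun Y => (VectorField.lieBracket ℝ (relativeField i) (relativeField j) Y.1, 0) :=
    (continuous_fst.continuousAt.eventually_ne hX).mono fun Y hY =>
      lieBracket_sphereTracerField i j hY
  rw [Filter.EventuallyEq.lieBracket_vectorField_eq (Filter.EventuallyEq.refl _ _) h]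
  exact lieBracket_prod_const _ _ (differentiableAt_relativeField k hX)
    (differentiableAt_lieBracket_relativeField hX i j)

lemma bracketSpan_sphereTracerField {X : R3 × R3} (hX : 1 < ‖X.1‖) :
    bracketSpan sphereTracerField X = ⊤ := by
  have hX0 : X.1 ≠ 0 := norm_ne_zero_iff.mp (by positivity)
  have hfst : (bracketSpan sphereTracerField X).comap (LinearMap.inl ℝ R3 R3) = ⊤ := by
    obtain ⟨j, hj⟩ : ∃ j, X.1 j ≠ 0 := by
      by_contra! h
      exact hX0 (by ext j; simpa using h j)
    obtain ⟨i, hij⟩ : ∃ i : Fin 3, i ≠ j := exists_ne j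
    refine eq_top_of_lieBracket_mem hX
      (w := VectorField.lieBracket ℝ (relativeField i)
        (VectorField.lieBracket ℝ (relativeField i) (relativeField j)) X.1) (fun i j => ?_) ?_ ?_
    · exact Submodule.subset_span
        ⟨_, .bracket (.field i) (.field j), lieBracket_sphereTracerField i j hX0⟩
    · exact Submodule.subset_span ⟨_, .bracket (.field i) (.bracket (.field i) (.field j)),
        lieBracket_lieBracket_sphereTracerField i i j hX0⟩
    · rw [inner_lieBracket_lieBracket_relativeField hX0]
      have h1 : basisVec j i = 0 := by simp [basisVec, hij]
      have h2 : basisVec i i = 1 := by simp [basisVec]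
      rw [h1, h2]
      simpa using ⟨⟨radialCoeff_ne_zero hX, bracketCoeff_ne_zero hX⟩, hj⟩
  have hmem : ∀ v : R3, (v, (0 : R3)) ∈ bracketSpan sphereTracerField X := fun v => by
    have : v ∈ (bracketSpan sphereTracerField X).comap (LinearMap.inl ℝ R3 R3) := by
      rw [hfst]; trivial
    simpa using this
  have hsnd : ∀ i, ((0 : R3), basisVec i) ∈ bracketSpan sphereTracerField X := fun i => by
    have h : sphereTracerField i X ∈ bracketSpan sphereTracerField X :=
      Submodule.subset_span ⟨_, .field i, rfl⟩
    simpa [sphereTracerField] using Submodule.sub_mem _ h (hmem (relativeField i X.1))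
  refine Submodule.eq_top_iff'.mpr fun Y => ?_
  have h2 : ((0 : R3), Y.2) ∈ bracketSpan sphereTracerField X := by
    have h := Submodule.sum_mem (bracketSpan sphereTracerField X) (t := Finset.univ)
      (f := fun i => Y.2 i • ((0 : R3), basisVec i)) fun i _ => Submodule.smul_mem _ _ (hsnd i)
    have h3 : ∑ i, Y.2 i • ((0 : R3), basisVec i) = (0, Y.2) := by
      refine Prod.ext (by simp [Prod.fst_sum]) ?_
      simpa [Prod.snd_sum] using sum_smul_basisVec Y.2
    rwa [h3] at h
  simpa using Submodule.add_mem _ (hmem Y.1) h2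

/-! ### The reduced configuration -/

lemma norm_smul_basisVec {ρ : ℝ} (hρ : 0 < ρ) (i : Fin 3) : ‖ρ • basisVec i‖ = ρ := by
  simp [basisVec, norm_smul, abs_of_pos hρ]

lemma inner_smul_basisVec_left (ρ : ℝ) (i : Fin 3) (v : R3) :
    inner ℝ (ρ • basisVec i) v = ρ * v i := by
  rw [real_inner_smul_left, real_inner_comm, inner_basisVec]

lemma orthogonal_span_smul_basisVec_zero {ρ : ℝ} (hρ : ρ ≠ 0) :
    (ℝ ∙ (ρ • basisVec 0))ᗮ = Submodule.span ℝ {basisVec 1, basisVec 2} := by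
  ext v
  rw [Submodule.mem_orthogonal_singleton_iff_inner_right, inner_smul_basisVec_left,
    Submodule.mem_span_pair]
  constructor
  · intro h
    have h0 : v 0 = 0 := by simpa [hρ] using h
    refine ⟨v 1, v 2, ?_⟩
    conv_rhs => rw [← sum_smul_basisVec v]
    simp [Fin.sum_univ_three, h0]
  · rintro ⟨a, b, rfl⟩
    simp [basisVec]

lemma lieBracket_lieBracket_relativeField_apply_zero {ρ : ℝ} (hρ : 0 < ρ) {k : Fin 3}
    (hk : k ≠ 0) :
    (VectorField.lieBracket ℝ (relativeField k)
      (VectorField.lieBracket ℝ (relativeField 0) (relativeField k)) (ρ • basisVec 0)) 0 =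
      radialCoeff ρ * bracketCoeff ρ := by
  have hr : ρ • basisVec 0 ≠ 0 := norm_ne_zero_iff.mp (by rw [norm_smul_basisVec hρ]; exact hρ.ne')
  have h := inner_lieBracket_lieBracket_relativeField hr k 0 k
  rw [inner_smul_basisVec_left, norm_smul_basisVec hρ] at h
  have h1 : basisVec 0 k = 0 := by simp [basisVec, hk]
  have h2 : basisVec k k = 1 := by simp [basisVec]
  have h3 : basisVec 0 0 = 1 := by simp [basisVec]
  simp only [PiLp.smul_apply, smul_eq_mul, h1, h2, h3] at h
  exact mul_left_cancel₀ hρ.ne' (by linarith)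

lemma span_lieBracket_eq_top {ρ : ℝ} (hρ : 1 < ρ) {k : Fin 3} (hk : k ≠ 0) :
    Submodule.span ℝ
      {VectorField.lieBracket ℝ (relativeField 0) (relativeField 1) (ρ • basisVec 0),
       VectorField.lieBracket ℝ (relativeField 0) (relativeField 2) (ρ • basisVec 0),
       VectorField.lieBracket ℝ (relativeField k)
        (VectorField.lieBracket ℝ (relativeField 0) (relativeField k)) (ρ • basisVec 0)} = ⊤ := by
  have hρ0 : 0 < ρ := by linarith
  have hn := norm_smul_basisVec hρ0 0
  have hr : ρ • basisVec 0 ≠ 0 := norm_ne_zero_iff.mp (by rw [hn]; exact hρ0.ne')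
  set S := Submodule.span ℝ
      {VectorField.lieBracket ℝ (relativeField 0) (relativeField 1) (ρ • basisVec 0),
       VectorField.lieBracket ℝ (relativeField 0) (relativeField 2) (ρ • basisVec 0),
       VectorField.lieBracket ℝ (relativeField k)
        (VectorField.lieBracket ℝ (relativeField 0) (relativeField k)) (ρ • basisVec 0)} with hS
  have h1 : VectorField.lieBracket ℝ (relativeField 0) (relativeField 1) (ρ • basisVec 0) ∈ S :=
    Submodule.subset_span (by simp)
  have h2 : VectorField.lieBracket ℝ (relativeField 0) (relativeField 2) (ρ • basisVec 0) ∈ S :=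
    Submodule.subset_span (by simp)
  have h3 : VectorField.lieBracket ℝ (relativeField k)
      (VectorField.lieBracket ℝ (relativeField 0) (relativeField k)) (ρ • basisVec 0) ∈ S :=
    Submodule.subset_span (by simp)
  -- At `ρ e_x` the bracket of `g_y` and `g_z` vanishes; the others are among the generators.
  have h12 : VectorField.lieBracket ℝ (relativeField 1) (relativeField 2) (ρ • basisVec 0) = 0 := by
    rw [lieBracket_relativeField hr]
    simp [basisVec]
  have hswap : ∀ i j, VectorField.lieBracket ℝ (relativeField i) (relativeField j)
      (ρ • basisVec 0) ∈ S → VectorField.lieBracket ℝ (relativeField j) (relativeField i)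
      (ρ • basisVec 0) ∈ S := fun i j h => by
    rw [VectorField.lieBracket_swap]
    exact S.neg_mem h
  have hself : ∀ i, VectorField.lieBracket ℝ (relativeField i) (relativeField i)
      (ρ • basisVec 0) ∈ S := fun i => by simp
  have h12' : VectorField.lieBracket ℝ (relativeField 1) (relativeField 2) (ρ • basisVec 0) ∈ S :=
    h12 ▸ S.zero_mem
  refine eq_top_of_lieBracket_mem (hn ▸ hρ) (fun i j => ?_) h3 ?_
  · fin_cases i <;> fin_cases j
    · exact hself 0
    · exact h1
    · exact h2
    · exact hswap _ _ h1
    · exact hself 1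
    · exact h12'
    · exact hswap _ _ h2
    · exact hswap _ _ h12'
    · exact hself 2
  · rw [inner_smul_basisVec_left, lieBracket_lieBracket_relativeField_apply_zero hρ0 hk]
    exact mul_ne_zero hρ0.ne' (mul_ne_zero (radialCoeff_ne_zero hρ) (bracketCoeff_ne_zero hρ))


/-! ### Trajectories of driftless systems -/

section Steering

variable {E : Type*} [NormedAddCommGroup E] [NormedSpace ℝ E] {ι : Type*} [Fintype ι]
  {P : Set E} {g : ι → E → E}

/-- `Y₀` can be steered to `Y₁` inside `P` in every positive time. -/
def CanSteer (P : Set E) (g : ι → E → E) (Y₀ Y₁ : E) : Prop :=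
  ∀ T : ℝ, 0 < T → ∃ (F : ι → ℝ → ℝ) (X : ℝ → E), IsTrajectory P g T F X ∧ X 0 = Y₀ ∧ X T = Y₁

/-- A curve of class `C¹` that solves the equation in the classical sense is a trajectory. -/
lemma IsTrajectory.of_hasDerivAt [CompleteSpace E] (hg : ∀ i, ContinuousOn (g i) P) {T : ℝ}
    (hT : 0 ≤ T) {F : ι → ℝ → ℝ} {X : ℝ → E} (hFm : ∀ i, Measurable (F i))
    (hFc : ∀ i, ContinuousOn (F i) (Set.Icc 0 T)) (hP : ∀ t ∈ Set.Icc 0 T, X t ∈ P)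
    (hX : ∀ t ∈ Set.Icc 0 T, HasDerivAt X (∑ i, F i t • g i (X t)) t) :
    IsTrajectory P g T F X := by
  have hXc : ContinuousOn X (Set.Icc 0 T) := fun t ht => (hX t ht).continuousAt.continuousWithinAt
  have hv : ContinuousOn (fun t => ∑ i, F i t • g i (X t)) (Set.Icc 0 T) :=
    continuousOn_finsetSum _ fun i _ => (hFc i).smul ((hg i).comp hXc hP)
  have hsub : ∀ t ∈ Set.Icc 0 T, Set.uIcc 0 t ⊆ Set.Icc 0 T := fun t ht => by
    rw [Set.uIcc_of_le ht.1]
    exact Set.Icc_subset_Icc_right ht.2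
  refine ⟨hFm, ?_, hXc, hP, ?_, fun t ht => ?_⟩
  · choose C hC using fun i => isCompact_Icc.exists_bound_of_continuousOn (hFc i)
    refine ⟨∑ i, |C i|, fun i t ht => (hC i t ht).trans ((le_abs_self _).trans ?_)⟩
    exact Finset.single_le_sum (f := fun i => |C i|) (fun j _ => abs_nonneg (C j))
      (Finset.mem_univ i)
  · exact (hv.mono (hsub T ⟨hT, le_rfl⟩)).intervalIntegrable
  · rw [intervalIntegral.integral_eq_sub_of_hasDerivAt (fun s hs => hX s (hsub t ht hs))
      (hv.mono (hsub t ht)).intervalIntegrable]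
    abel

/-- Trajectories can be concatenated. -/
lemma IsTrajectory.append {T₁ T₂ : ℝ} (hT₁ : 0 ≤ T₁) (hT₂ : 0 ≤ T₂) {F₁ F₂ : ι → ℝ → ℝ}
    {X₁ X₂ : ℝ → E} (h₁ : IsTrajectory P g T₁ F₁ X₁) (h₂ : IsTrajectory P g T₂ F₂ X₂)
    (h : X₁ T₁ = X₂ 0) :
    IsTrajectory P g (T₁ + T₂) (fun i t => if t ≤ T₁ then F₁ i t else F₂ i (t - T₁))
      (fun t => if t ≤ T₁ then X₁ t else X₂ (t - T₁)) := by
  set F : ι → ℝ → ℝ := fun i t => if t ≤ T₁ then F₁ i t else F₂ i (t - T₁) with hF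
  set X : ℝ → E := fun t => if t ≤ T₁ then X₁ t else X₂ (t - T₁) with hX
  have hv₁ : ∀ t ≤ T₁, ∑ i, F i t • g i (X t) = ∑ i, F₁ i t • g i (X₁ t) := fun t ht => by
    simp [hF, hX, ht]
  have hv₂ : ∀ t, T₁ < t → ∑ i, F i t • g i (X t) =
      ∑ i, F₂ i (t - T₁) • g i (X₂ (t - T₁)) := fun t ht => by
    simp [hF, hX, ht.not_ge]
  have hI₁ : IntervalIntegrable (fun t => ∑ i, F i t • g i (X t)) MeasureTheory.volume 0 T₁ := by
    refine h₁.integrable_velocity.congr fun t ht => ?_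
    rw [Set.uIoc_of_le hT₁] at ht
    exact (hv₁ t ht.2).symm
  have hI₂ : IntervalIntegrable (fun t => ∑ i, F i t • g i (X t)) MeasureTheory.volume
      T₁ (T₁ + T₂) := by
    have h3 := h₂.integrable_velocity.comp_sub_right T₁
    rw [zero_add, add_comm T₂] at h3
    refine h3.congr fun t ht => ?_
    rw [Set.uIoc_of_le (by linarith)] at ht
    exact (hv₂ t ht.1).symm
  have hX0 : X 0 = X₁ 0 := by simp [hX, hT₁]
  have hint : IntervalIntegrable (fun t => ∑ i, F i t • g i (X t)) MeasureTheory.volume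
      0 (T₁ + T₂) := hI₁.trans hI₂
  have hstate : ∀ t ∈ Set.Icc 0 (T₁ + T₂),
      X t = X 0 + ∫ s in (0 : ℝ)..t, ∑ i, F i s • g i (X s) := by
    intro t ht
    have hleft : ∀ t ∈ Set.Icc 0 T₁, (∫ s in (0 : ℝ)..t, ∑ i, F i s • g i (X s)) =
        ∫ s in (0 : ℝ)..t, ∑ i, F₁ i s • g i (X₁ s) := fun t ht =>
      intervalIntegral.integral_congr fun s hs => by
        rw [Set.uIcc_of_le ht.1] at hs
        exact hv₁ s (hs.2.trans ht.2)
    rcases le_or_gt t T₁ with htT | htT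
    · rw [hX0, hleft t ⟨ht.1, htT⟩, ← h₁.state_eq t ⟨ht.1, htT⟩]
      simp [hX, htT]
    · have hright : (∫ s in T₁..t, ∑ i, F i s • g i (X s)) =
          ∫ s in (0 : ℝ)..(t - T₁), ∑ i, F₂ i s • g i (X₂ s) := by
        have hshift := intervalIntegral.integral_comp_sub_right
          (fun s => ∑ i, F₂ i s • g i (X₂ s)) T₁ (a := T₁) (b := t)
        rw [sub_self] at hshift
        rw [← hshift]
        refine intervalIntegral.integral_congr_ae (.of_forall fun s hs => ?_)
        rw [Set.uIoc_of_le htT.le] at hs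
        exact hv₂ s hs.1
      have hI₂' : IntervalIntegrable (fun t => ∑ i, F i t • g i (X t)) MeasureTheory.volume
          T₁ t := hI₂.mono_set (by
        rw [Set.uIcc_of_le htT.le, Set.uIcc_of_le (by linarith)]
        exact Set.Icc_subset_Icc_right ht.2)
      rw [← intervalIntegral.integral_add_adjacent_intervals hI₁ hI₂', hright, hX0,
        hleft T₁ ⟨hT₁, le_rfl⟩, ← add_assoc, ← h₁.state_eq T₁ ⟨hT₁, le_rfl⟩, h,
        ← h₂.state_eq (t - T₁) ⟨by linarith, by linarith [ht.2]⟩]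
      simp [hX, htT.not_ge]
  refine ⟨fun i => ?_, ?_, ?_, fun t ht => ?_, hint, hstate⟩
  · exact Measurable.ite measurableSet_Iic (h₁.measurable_control i)
      ((h₂.measurable_control i).comp (measurable_id.sub_const T₁))
  · obtain ⟨C₁, hC₁⟩ := h₁.bounded_control
    obtain ⟨C₂, hC₂⟩ := h₂.bounded_control
    refine ⟨max C₁ C₂, fun i t ht => ?_⟩
    rcases le_or_gt t T₁ with htT | htT
    · simpa [hF, htT] using Or.inl (hC₁ i t ⟨ht.1, htT⟩)
    · simpa [hF, htT.not_ge] using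
        Or.inr (hC₂ i (t - T₁) ⟨by linarith, by linarith [ht.2]⟩)
  -- Continuity of the concatenated curve follows from its integral equation.
  · have hc := intervalIntegral.continuousOn_primitive_interval' hint Set.left_mem_uIcc
    rw [Set.uIcc_of_le (by linarith)] at hc
    exact (continuousOn_const.add hc).congr hstate
  · rcases le_or_gt t T₁ with htT | htT
    · simpa [hX, htT] using h₁.mem_stateSpace t ⟨ht.1, htT⟩
    · simpa [hX, htT.not_ge] using
        h₂.mem_stateSpace (t - T₁) ⟨by linarith, by linarith [ht.2]⟩

lemma CanSteer.trans {Y₀ Y₁ Y₂ : E} (h₁ : CanSteer P g Y₀ Y₁) (h₂ : CanSteer P g Y₁ Y₂) :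
    CanSteer P g Y₀ Y₂ := by
  intro T hT
  obtain ⟨F₁, X₁, hX₁, h10, h11⟩ := h₁ (T / 2) (half_pos hT)
  obtain ⟨F₂, X₂, hX₂, h20, h21⟩ := h₂ (T / 2) (half_pos hT)
  have h := hX₁.append (half_pos hT).le (half_pos hT).le hX₂ (h11.trans h20.symm)
  rw [add_halves] at h
  refine ⟨_, _, h, ?_, ?_⟩
  · simpa [(half_pos hT).le] using h10
  · have : ¬ T ≤ T / 2 := by linarith
    simpa [this, sub_half] using h21

end Steering

/-! ### Radial moves and great arcs -/

lemma continuousOn_sphereTracerField (i : Fin 3) :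
    ContinuousOn (sphereTracerField i) admissibleSpace := fun X hX => by
  have hX0 : X.1 ≠ 0 := norm_ne_zero_iff.mp (zero_lt_one.trans hX).ne'
  have h := (differentiableAt_relativeField i hX0).continuousAt
  exact ((h.comp continuousAt_fst).prodMk continuousAt_const).continuousWithinAt

lemma sum_smul_sphereTracerField (f : R3) (X : R3 × R3) :
    ∑ i, f i • sphereTracerField i X = (relativeVelocity f X.1, f) := by
  refine Prod.ext ?_ (by simpa [sphereTracerField, Prod.snd_sum] using sum_smul_basisVec f)
  conv_rhs => rw [← sum_smul_basisVec f]
  simp only [sphereTracerField, Prod.fst_sum, Prod.smul_mk, relativeField, relativeVelocity_eq,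
    inner_sum, inner_smul_right, smul_add, Finset.sum_add_distrib, Finset.smul_sum,
    Finset.mul_sum, Finset.sum_smul, smul_smul]
  congr 1
  · exact Finset.sum_congr rfl fun i _ => by rw [mul_comm]
  · exact Finset.sum_congr rfl fun i _ => by congr 1; ring

/-- Tracer and sphere positions that solve the equations of motion for a velocity `f` of the
sphere form a trajectory. -/
lemma isTrajectory_of_hasDerivAt {T : ℝ} (hT : 0 ≤ T) {f r x : ℝ → R3} (hfm : Measurable f)
    (hfc : ContinuousOn f (Set.Icc 0 T)) (hr1 : ∀ t ∈ Set.Icc 0 T, 1 < ‖r t‖)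
    (hr : ∀ t ∈ Set.Icc 0 T, HasDerivAt r (relativeVelocity (f t) (r t)) t)
    (hx : ∀ t ∈ Set.Icc 0 T, HasDerivAt x (f t) t) :
    IsTrajectory admissibleSpace sphereTracerField T (fun i t => f t i)
      (fun t => (r t, x t)) := by
  refine .of_hasDerivAt continuousOn_sphereTracerField hT (fun i => ?_) (fun i => ?_) hr1
    fun t ht => ?_
  · exact (EuclideanSpace.proj i : R3 →L[ℝ] ℝ).continuous.measurable.comp hfm
  · exact (EuclideanSpace.proj i : R3 →L[ℝ] ℝ).continuous.comp_continuousOn hfc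
  · rw [sum_smul_sphereTracerField]
    exact (hr t ht).prodMk (hx t ht)

/-- Displacement of the sphere along a radial move from distance `2` to distance `ρ`. -/
def radialShift (ρ : ℝ) : ℝ := ∫ s in (2 : ℝ)..ρ, (radialCoeff s)⁻¹

/-- Displacement of the sphere, per unit change of direction, along an arc of radius `ρ`. -/
def arcShift (ρ : ℝ) : ℝ := ρ / transverseCoeff ρ

lemma measurable_radialCoeff : Measurable radialCoeff := by
  unfold radialCoeff transverseCoeff dyadicCoeff
  fun_prop

lemma continuousOn_inv_radialCoeff : ContinuousOn (fun s => (radialCoeff s)⁻¹) (Set.Ioi 1) := by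
  intro s (hs : 1 < s)
  have hs0 : s ≠ 0 := by positivity
  have h : ContinuousAt radialCoeff s :=
    (hasDerivAt_transverseCoeff hs0).continuousAt.add
      ((differentiableAt_dyadicCoeff hs0).continuousAt.mul (continuousAt_id.pow 2))
  exact (h.inv₀ (radialCoeff_ne_zero hs)).continuousWithinAt

lemma hasDerivAt_radialShift {ρ : ℝ} (hρ : 1 < ρ) :
    HasDerivAt radialShift (radialCoeff ρ)⁻¹ ρ := by
  refine intervalIntegral.integral_hasDerivAt_right
    (continuousOn_inv_radialCoeff.mono fun s hs => ?_).intervalIntegrable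
    measurable_radialCoeff.inv.stronglyMeasurable.stronglyMeasurableAtFilter
    (continuousOn_inv_radialCoeff.continuousAt (Ioi_mem_nhds hρ))
  exact (lt_min one_lt_two hρ).trans_le hs.1

lemma canSteer_radial {ρ₁ ρ₂ : ℝ} (h₁ : 1 < ρ₁) (h₂ : 1 < ρ₂) {u : R3} (hu : ‖u‖ = 1) (x : R3) :
    CanSteer admissibleSpace sphereTracerField (ρ₁ • u, x)
      (ρ₂ • u, x + (radialShift ρ₂ - radialShift ρ₁) • u) := by
  intro T hT
  -- The distance is prescribed as an affine function of time and the control is read off from it.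
  set c : ℝ := (ρ₂ - ρ₁) / T with hc
  set ρ : ℝ → ℝ := fun t => ρ₁ + c * t with hρ
  have hρT : ρ T = ρ₂ := by simp only [hρ, hc]; field_simp; ring
  have hρ' : ∀ t, HasDerivAt ρ c t := fun t =>
    (((hasDerivAt_id t).const_mul c).const_add ρ₁).congr_deriv (mul_one c)
  have hρc : Continuous ρ := by fun_prop
  have hρ1 : ∀ t ∈ Set.Icc 0 T, 1 < ρ t := fun t ht => by
    have h : ρ t = (1 - t / T) * ρ₁ + t / T * ρ₂ := by simp only [hρ, hc]; field_simp; ring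
    have ht0 : 0 ≤ t / T := div_nonneg ht.1 hT.le
    have ht1 : t / T ≤ 1 := (div_le_one hT).mpr ht.2
    rw [h]
    exact convex_Ioi (1 : ℝ) h₁ h₂ (sub_nonneg.mpr ht1) ht0 (sub_add_cancel _ _)
  refine ⟨_, _, isTrajectory_of_hasDerivAt (f := fun t => (c * (radialCoeff (ρ t))⁻¹) • u)
    (r := fun t => ρ t • u) (x := fun t => x + (radialShift (ρ t) - radialShift ρ₁) • u)
    hT.le ?_ ?_ ?_ ?_ ?_, ?_, ?_⟩
  · exact ((measurable_radialCoeff.comp hρc.measurable).inv.const_mul c).smul_const u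
  · exact (continuousOn_const.mul (continuousOn_inv_radialCoeff.comp hρc.continuousOn hρ1)).smul
      continuousOn_const
  · intro t ht
    have := hρ1 t ht
    simpa [norm_smul, hu, abs_of_pos (zero_lt_one.trans this)] using this
  · intro t ht
    have ht1 := hρ1 t ht
    refine ((hρ' t).smul_const u).congr_deriv ?_
    have hn : ‖ρ t • u‖ = ρ t := by
      rw [norm_smul, hu, mul_one, Real.norm_of_nonneg (by linarith)]
    have hrad := radialCoeff_ne_zero ht1
    rw [relativeVelocity_eq, hn, real_inner_smul_left, inner_smul_right,
      real_inner_self_eq_norm_sq, hu, smul_smul, smul_smul, ← add_smul]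
    congr 1
    have : transverseCoeff (ρ t) = radialCoeff (ρ t) - dyadicCoeff (ρ t) * ρ t ^ 2 := by
      rw [radialCoeff]; ring
    rw [this]
    field_simp
    ring
  · intro t ht
    refine (((((hasDerivAt_radialShift (hρ1 t ht)).comp t (hρ' t)).sub_const _).smul_const
      u).const_add x).congr_deriv ?_
    rw [mul_comm]
  · simp [hρ]
  · simp [hρT]

lemma norm_cos_smul_add_sin_smul {u v : R3} (hu : ‖u‖ = 1) (hv : ‖v‖ = 1) (huv : inner ℝ u v = 0)
    (θ : ℝ) : ‖Real.cos θ • u + Real.sin θ • v‖ = 1 := by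
  have h : ‖Real.cos θ • u + Real.sin θ • v‖ ^ 2 = 1 := by
    rw [norm_add_sq_real, norm_smul, norm_smul, real_inner_smul_left, inner_smul_right, huv, hu, hv]
    simp
  exact (pow_eq_one_iff_of_nonneg (norm_nonneg _) two_ne_zero).mp h

/-- Every vector of `ℝ³` is orthogonal to some unit vector. -/
lemma exists_norm_eq_one_inner_eq_zero (z : R3) : ∃ v : R3, ‖v‖ = 1 ∧ inner ℝ z v = 0 := by
  have h : (ℝ ∙ z)ᗮ ≠ ⊥ := fun h => by
    have h1 := (ℝ ∙ z).finrank_add_finrank_orthogonal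
    have h2 : Module.finrank ℝ (ℝ ∙ z) ≤ 1 := by
      simpa using finrank_span_le_card (R := ℝ) ({z} : Set R3)
    rw [h, finrank_bot, finrank_euclideanSpace_fin] at h1
    omega
  obtain ⟨w, hw, hw0⟩ := Submodule.exists_mem_ne_zero_of_ne_bot h
  refine ⟨‖w‖⁻¹ • w, norm_smul_inv_norm (𝕜 := ℝ) hw0, ?_⟩
  rw [inner_smul_right, Submodule.mem_orthogonal_singleton_iff_inner_right.mp hw, mul_zero]

/-- Any two unit vectors lie on a common great circle. -/
lemma exists_eq_cos_smul_add_sin_smul {u w : R3} (hu : ‖u‖ = 1) (hw : ‖w‖ = 1) :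
    ∃ (v : R3) (θ : ℝ), ‖v‖ = 1 ∧ inner ℝ u v = 0 ∧ w = Real.cos θ • u + Real.sin θ • v := by
  set c : ℝ := inner ℝ u w with hc
  set d : R3 := w - c • u with hd
  have hud : inner ℝ u d = 0 := by
    rw [hd, inner_sub_right, inner_smul_right, real_inner_self_eq_norm_sq, hu, ← hc]; ring
  -- `d` is the part of `w` orthogonal to `u`, so `‖d‖` is the sine of the angle between them.
  have hdn : ‖d‖ ^ 2 = 1 - c ^ 2 := by
    rw [hd, norm_sub_sq_real, inner_smul_right, real_inner_comm, ← hc, norm_smul, hu, hw,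
      Real.norm_eq_abs, mul_one, sq_abs]
    ring
  have hc1 : |c| ≤ 1 := by simpa [hu, hw] using abs_real_inner_le_norm u w
  obtain ⟨v, hv, huv, hdv⟩ : ∃ v : R3, ‖v‖ = 1 ∧ inner ℝ u v = 0 ∧ d = ‖d‖ • v := by
    by_cases h0 : d = 0
    · obtain ⟨v, hv, huv⟩ := exists_norm_eq_one_inner_eq_zero u
      exact ⟨v, hv, huv, by simp [h0]⟩
    · refine ⟨‖d‖⁻¹ • d, norm_smul_inv_norm (𝕜 := ℝ) h0, ?_, ?_⟩
      · rw [inner_smul_right, hud, mul_zero]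
      · rw [smul_inv_smul₀ (norm_ne_zero_iff.mpr h0)]
  refine ⟨v, Real.arccos c, hv, huv, ?_⟩
  rw [Real.cos_arccos (abs_le.mp hc1).1 (abs_le.mp hc1).2, Real.sin_arccos, ← hdn,
    Real.sqrt_sq (norm_nonneg _), ← hdv, hd]
  abel

lemma canSteer_arc {ρ : ℝ} (hρ : 1 < ρ) {u w : R3} (hu : ‖u‖ = 1) (hw : ‖w‖ = 1) (x : R3) :
    CanSteer admissibleSpace sphereTracerField (ρ • u, x) (ρ • w, x + arcShift ρ • (w - u)) := by
  intro T hT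
  obtain ⟨v, θ, hv, huv, rfl⟩ := exists_eq_cos_smul_add_sin_smul hu hw
  set q : ℝ → R3 := fun t => Real.cos (θ / T * t) • u + Real.sin (θ / T * t) • v with hq
  set q' : ℝ → R3 := fun t =>
    (θ / T) • (-Real.sin (θ / T * t) • u + Real.cos (θ / T * t) • v) with hq'
  have hder : ∀ t, HasDerivAt q (q' t) t := fun t => by
    have h : HasDerivAt (fun t => θ / T * t) (θ / T) t := by
      simpa using (hasDerivAt_id t).const_mul (θ / T)
    refine ((h.cos.smul_const u).add (h.sin.smul_const v)).congr_deriv ?_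
    simp only [hq']
    module
  have hqn : ∀ t, ‖q t‖ = 1 := fun t => norm_cos_smul_add_sin_smul hu hv huv _
  have hqq : ∀ t, inner ℝ (q t) (q' t) = 0 := fun t => by
    simp only [hq, hq', inner_add_left, inner_add_right, real_inner_smul_left, inner_smul_right,
      real_inner_comm u v, huv, real_inner_self_eq_norm_sq, hu, hv]
    ring
  have hqc : Continuous q' := by fun_prop
  refine ⟨_, _, isTrajectory_of_hasDerivAt (f := fun t => arcShift ρ • q' t)
    (r := fun t => ρ • q t) (x := fun t => x + arcShift ρ • (q t - u))
    hT.le ?_ ?_ ?_ ?_ ?_, ?_, ?_⟩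
  · exact (hqc.const_smul (arcShift ρ)).measurable
  · exact (hqc.const_smul (arcShift ρ)).continuousOn
  · intro t _
    simpa [norm_smul, hqn, abs_of_pos (zero_lt_one.trans hρ)] using hρ
  · intro t _
    refine ((hder t).const_smul ρ).congr_deriv ?_
    have hn : ‖ρ • q t‖ = ρ := by
      rw [norm_smul, hqn, mul_one, Real.norm_of_nonneg (by linarith)]
    rw [relativeVelocity_eq, hn, real_inner_smul_left, inner_smul_right, hqq,
      mul_zero, mul_zero, mul_zero, zero_smul, add_zero, arcShift,
      smul_smul (transverseCoeff ρ), mul_div_cancel₀ _ (transverseCoeff_ne_zero hρ)]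
  · intro t _
    exact (((hder t).sub_const u).const_smul (arcShift ρ)).const_add x
  · simp [hq]
  · have : θ / T * T = θ := div_mul_cancel₀ _ hT.ne'
    simp [hq, this]

/-! ### Loops of the tracer and controllability -/

/-- The displacement of the sphere, per unit change of direction, produced by the loop of the
tracer that uses the distances `ρ₁` and `ρ₂`. -/
def loopShift (ρ₁ ρ₂ : ℝ) : ℝ :=
  (radialShift ρ₂ - radialShift ρ₁) - (arcShift ρ₂ - arcShift ρ₁)

/-- The tracer goes out from `ρ₁ p` to `ρ₂ p`, along an arc to `ρ₂ q`, back to `ρ₁ q`, and along an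
arc to `ρ₁ p`; meanwhile the sphere is displaced by a multiple of `p - q`. -/
lemma canSteer_loop {ρ₁ ρ₂ : ℝ} (h₁ : 1 < ρ₁) (h₂ : 1 < ρ₂) {p q : R3} (hp : ‖p‖ = 1)
    (hq : ‖q‖ = 1) (x : R3) :
    CanSteer admissibleSpace sphereTracerField (ρ₁ • p, x)
      (ρ₁ • p, x + loopShift ρ₁ ρ₂ • (p - q)) := by
  have h := (((canSteer_radial h₁ h₂ hp x).trans (canSteer_arc h₂ hp hq _)).trans
    (canSteer_radial h₂ h₁ hq _)).trans (canSteer_arc h₁ hq hp _)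
  convert h using 2
  unfold loopShift
  module

/-- Conjugating a loop by arcs of radius `ρ₁` lets it start in any direction `u`. -/
lemma canSteer_loop_of_direction {ρ₁ ρ₂ : ℝ} (h₁ : 1 < ρ₁) (h₂ : 1 < ρ₂) {u p q : R3}
    (hu : ‖u‖ = 1) (hp : ‖p‖ = 1) (hq : ‖q‖ = 1) (x : R3) :
    CanSteer admissibleSpace sphereTracerField (ρ₁ • u, x)
      (ρ₁ • u, x + loopShift ρ₁ ρ₂ • (p - q)) := by
  have h := ((canSteer_arc h₁ hu hp x).trans (canSteer_loop h₁ h₂ hp hq _)).trans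
    (canSteer_arc h₁ hp hu _)
  convert h using 2
  module

/-- The displacement of a loop is not identically zero: otherwise `radialShift` and `arcShift`
would have the same derivative, while at `ρ = 2` these are `-16 / 5` and `-128 / 361`. -/
lemma exists_loopShift_ne_zero : ∃ ρ₁ ρ₂ : ℝ, 1 < ρ₁ ∧ 1 < ρ₂ ∧ loopShift ρ₁ ρ₂ ≠ 0 := by
  by_contra! h
  have hA := hasDerivAt_transverseCoeff (two_ne_zero (α := ℝ))
  have hA2 : transverseCoeff 2 = -19 / 32 := by norm_num [transverseCoeff]
  have hR2 : radialCoeff 2 = -5 / 16 := by norm_num [radialCoeff_eq]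
  have h1 : HasDerivAt (loopShift 2) _ 2 :=
    ((hasDerivAt_radialShift one_lt_two).sub_const (radialShift 2)).sub
      (((hasDerivAt_id (2 : ℝ)).div hA (by rw [hA2]; norm_num)).sub_const (arcShift 2))
  have h2 : HasDerivAt (loopShift 2) 0 2 :=
    (hasDerivAt_const (2 : ℝ) (0 : ℝ)).congr_of_eventuallyEq
      ((eventually_gt_nhds one_lt_two).mono fun ρ hρ => h 2 ρ one_lt_two hρ)
  have h3 := h1.unique h2
  rw [hA2, hR2] at h3
  norm_num at h3

/-- Every vector of norm at most `2` is a difference of unit vectors. -/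
lemma exists_sub_eq_of_norm_le_two {z : R3} (hz : ‖z‖ ≤ 2) :
    ∃ p q : R3, ‖p‖ = 1 ∧ ‖q‖ = 1 ∧ p - q = z := by
  obtain ⟨v, hv, hzv⟩ := exists_norm_eq_one_inner_eq_zero z
  set s : ℝ := √(1 - ‖z‖ ^ 2 / 4) with hs
  have hs2 : s ^ 2 = 1 - ‖z‖ ^ 2 / 4 := Real.sq_sqrt (by nlinarith [norm_nonneg z])
  have hn : ∀ a : ℝ, a ^ 2 = 1 / 4 → ‖a • z + s • v‖ = 1 := fun a ha => by
    refine (pow_eq_one_iff_of_nonneg (norm_nonneg _) two_ne_zero).mp ?_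
    rw [norm_add_sq_real, norm_smul, norm_smul, real_inner_smul_left, inner_smul_right, hzv, hv,
      mul_pow, mul_pow, Real.norm_eq_abs, Real.norm_eq_abs, sq_abs, sq_abs, ha, hs2]
    ring
  -- The two unit vectors are mirror images in the plane orthogonal to `z`.
  refine ⟨(1 / 2 : ℝ) • z + s • v, (-1 / 2 : ℝ) • z + s • v, hn _ (by norm_num),
    hn _ (by norm_num), by module⟩

/-- Repeated loops of the tracer displace the sphere arbitrarily. -/
lemma canSteer_translate {ρ₁ ρ₂ : ℝ} (h₁ : 1 < ρ₁) (h₂ : 1 < ρ₂) (hκ : loopShift ρ₁ ρ₂ ≠ 0)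
    {u : R3} (hu : ‖u‖ = 1) (x y : R3) :
    CanSteer admissibleSpace sphereTracerField (ρ₁ • u, x) (ρ₁ • u, y) := by
  set κ := loopShift ρ₁ ρ₂ with hκd
  obtain ⟨n, hn⟩ := exists_nat_gt ‖κ⁻¹ • (y - x)‖
  have hn0 : (0 : ℝ) < n := (norm_nonneg _).trans_lt hn
  obtain ⟨p, q, hp, hq, hpq⟩ := exists_sub_eq_of_norm_le_two
    (z := (n : ℝ)⁻¹ • κ⁻¹ • (y - x)) (by
      rw [norm_smul, norm_inv, Real.norm_of_nonneg hn0.le, inv_mul_le_iff₀ hn0]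
      linarith)
  have hm : ∀ m : ℕ, CanSteer admissibleSpace sphereTracerField (ρ₁ • u, x)
      (ρ₁ • u, x + (m : ℝ) • κ • (p - q)) := by
    intro m
    induction m with
    | zero => simpa using canSteer_arc h₁ hu hu x
    | succ m ih =>
      convert ih.trans (canSteer_loop_of_direction h₁ h₂ hu hp hq _) using 2
      push_cast
      module
  convert hm n using 2
  rw [hpq, smul_comm κ, smul_inv_smul₀ hn0.ne', smul_inv_smul₀ hκ]
  abel

lemma isControllableWithin_admissibleSpace :
    IsControllableWithin admissibleSpace sphereTracerField admissibleSpace := by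
  rintro ⟨r₀, x₀⟩ (h₀ : 1 < ‖r₀‖) ⟨r₁, x₁⟩ (h₁ : 1 < ‖r₁‖)
  have polar : ∀ {r : R3}, 1 < ‖r‖ → ∃ u : R3, ‖u‖ = 1 ∧ ‖r‖ • u = r := fun {r} hr => by
    have hr0 : r ≠ 0 := norm_ne_zero_iff.mp (zero_lt_one.trans hr).ne'
    exact ⟨‖r‖⁻¹ • r, norm_smul_inv_norm (𝕜 := ℝ) hr0, smul_inv_smul₀ (norm_ne_zero_iff.mpr hr0) r⟩
  obtain ⟨u₀, hu₀, hr₀⟩ := polar h₀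
  obtain ⟨u₁, hu₁, hr₁⟩ := polar h₁
  obtain ⟨ρ, ρ', hρ, hρ', hκ⟩ := exists_loopShift_ne_zero
  have h := (((canSteer_radial h₀ hρ hu₀ x₀).trans (canSteer_arc hρ hu₀ hu₁ _)).trans
    (canSteer_translate hρ hρ' hκ hu₁ _
      (x₁ - (radialShift ‖r₁‖ - radialShift ρ) • u₁))).trans (canSteer_radial hρ h₁ hu₁ _)
  rw [sub_add_cancel, hr₀, hr₁] at h
  exact h

end

theorem mainTheorem2 :
    -- the system is controllable on the whole admissible state space
    IsControllableWithin admissibleSpace sphereTracerField admissibleSpace ∧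
    -- the iterated brackets have full rank (six) at every admissible state
    controllableStateSet admissibleSpace sphereTracerField = admissibleSpace ∧
    -- second-order brackets
    (∀ r : R3, r ≠ 0 → ∀ i j : Fin 3,
      VectorField.lieBracket ℝ (relativeField i) (relativeField j) r =
        (-3 * (‖r‖ - 1) ^ 2 * (8 * ‖r‖ ^ 3 + 7 * ‖r‖ ^ 2 + 6 * ‖r‖ + 3) / (16 * ‖r‖ ^ 8)) •
          (r j • basisVec i - r i • basisVec j)) ∧
    -- they span a plane at every admissible relative position
    (∀ r : R3, 1 < ‖r‖ →
      Module.finrank ℝ (Submodule.span ℝ (Set.range fun p : Fin 3 × Fin 3 =>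
        VectorField.lieBracket ℝ (relativeField p.1) (relativeField p.2) r)) = 2) ∧
    -- and this is the plane of `e_y` and `e_z` in the reduced configuration
    (∀ ρ : ℝ, 1 < ρ →
      Submodule.span ℝ (Set.range fun p : Fin 3 × Fin 3 =>
        VectorField.lieBracket ℝ (relativeField p.1) (relativeField p.2) (ρ • basisVec 0)) =
      Submodule.span ℝ {basisVec 1, basisVec 2}) ∧
    -- `e_x` components of `[g_y, [g_x, g_y]]` and `[g_z, [g_x, g_z]]` there
    (∀ ρ : ℝ, 0 < ρ → ∀ k : Fin 3, k ≠ 0 →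
      (VectorField.lieBracket ℝ (relativeField k)
        (VectorField.lieBracket ℝ (relativeField 0) (relativeField k)) (ρ • basisVec 0)) 0 =
      3 * (ρ - 1) ^ 4 * (2 * ρ + 1) * (8 * ρ ^ 3 + 7 * ρ ^ 2 + 6 * ρ + 3) / (32 * ρ ^ 11)) ∧
    -- neither factor vanishes outside the sphere
    (∀ ρ : ℝ, 1 < ρ →
      (ρ - 1) ^ 2 * (8 * ρ ^ 3 + 7 * ρ ^ 2 + 6 * ρ + 3) ≠ 0 ∧
      (ρ - 1) ^ 4 * (2 * ρ + 1) * (8 * ρ ^ 3 + 7 * ρ ^ 2 + 6 * ρ + 3) ≠ 0) ∧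
    -- hence brackets of orders two and three span all directions of the relative position
    (∀ ρ : ℝ, 1 < ρ → ∀ k : Fin 3, k ≠ 0 →
      Submodule.span ℝ
        {VectorField.lieBracket ℝ (relativeField 0) (relativeField 1) (ρ • basisVec 0),
         VectorField.lieBracket ℝ (relativeField 0) (relativeField 2) (ρ • basisVec 0),
         VectorField.lieBracket ℝ (relativeField k)
          (VectorField.lieBracket ℝ (relativeField 0) (relativeField k)) (ρ • basisVec 0)} = ⊤) := by

  refine ⟨isControllableWithin_admissibleSpace, ?_, fun r hr i j => lieBracket_relativeField hr i j,
    fun r hr => ?_, fun ρ hρ => ?_, fun ρ hρ k hk => ?_, fun ρ hρ => ?_,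
    fun ρ hρ k hk => span_lieBracket_eq_top hρ hk⟩
  · refine Set.Subset.antisymm (fun X hX => hX.1) fun X hX => ⟨hX, ?_⟩
    rw [bracketSpan_sphereTracerField hX, finrank_top]
  · have hr0 : r ≠ 0 := norm_ne_zero_iff.mp (zero_lt_one.trans hr).ne'
    have : Fact (Module.finrank ℝ R3 = 2 + 1) := ⟨finrank_euclideanSpace_fin⟩
    rw [span_lieBracket_relativeField hr, Submodule.finrank_orthogonal_span_singleton (n := 2) hr0]
  · have hρ0 : 0 < ρ := zero_lt_one.trans hρ
    rw [span_lieBracket_relativeField (by rwa [norm_smul_basisVec hρ0]),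
      orthogonal_span_smul_basisVec_zero hρ0.ne']
  · rw [lieBracket_lieBracket_relativeField_apply_zero hρ hk, radialCoeff_eq hρ.ne', bracketCoeff]
    field_simp
    ring
  · have : 0 < ρ - 1 := by linarith
    constructor <;> positivity
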